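/- Let $\mathcal{N}=\{1,\dots,n\}$ be a set of products. A marginal distribution model (MDM) consists of deterministic utilities $\nu_1,\dots,\nu_n\in\mathbb{R}$ and laws of real random variables $\tilde\epsilon_1,\dots,\tilde\epsilon_n$, each absolutely continuous, with finite first moment and with a distribution function $F_i$ that is strictly increasing on its support. For a nonempty assortment $S\subseteq\mathcal{N}$, its choice probabilities are $p_{i,S}=\mathbb{P}_{\theta^*}\big(i\in\arg\max_{j\in S}\{\nu_j+\tilde\epsilon_j\}\big)$, $i\in S$, where $\theta^*$ attains the maximum of $\mathbb{E}_\theta\big[\max_{j\in S}\{\nu_j+\tilde\epsilon_j\}\big]$ over all joint distributions $\theta$ of $(\tilde\epsilon_1,\dots,\tilde\epsilon_n)$ with marginals $F_1,\dots,F_n$. For a collection $\mathcal{S}$ of assortments, let $\mathcal{P}_{\rm mdm}(\mathcal{S})$ be the set of all families $(p_{i,S}: S\in\mathcal{S}, i\in S)$ with $p_{i,S}\ge 0$ and $\sum_{i\in S}p_{i,S}=1$ for every $S\in\mathcal{S}$ that are the choice probabilities of a single MDM for all $S\in\mathcal{S}$. Let $\mathcal{S}=\{S_1,\dots,S_m\}$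 be nested, $S_1\subset S_2\subset\dots\subset S_m$ (strict inclusions, $m=|\mathcal{S}|\ge 0$), let $p_{\mathcal{S}}\in\mathcal{P}_{\rm mdm}(\mathcal{S})$, let $r_i>0$ for $i\in\mathcal{N}$, and let $A\subseteq\mathcal{N}$ be a nonempty assortment with $A\notin\mathcal{S}$. The worst-case expected revenue of $A$ is $$\underline{r}(A)=\inf\Big\{\sum_{i\in A}r_i x_{i,A}\;:\;(p_{\mathcal{S}},x_A)\in\mathcal{P}_{\rm mdm}(\mathcal{S}\cup\{A\})\Big\}.$$ Then $$\underline{r}(A)=\min_{k=0,1,\dots,m} R_k,$$ where $R_k$ is the optimal value ($+\infty$ if infeasible) of the linear program $$\begin{aligned}R_k=\min_{x_A}\ &\sum_{i\in A}r_i x_{i,A}\\ \text{s.t. }\ & x_{i,A}\le p_{i,S_k}\quad \forall\, i\in A\cap S_k,\\ & x_{i,A}\ge p_{i,S}\quad \forall\, S\in\mathcal{S} \text{ with } S_{k+1}\subseteq S,\ \forall\, i\in A\cap S,\\ & \sum_{i\in A}x_{i,A}=1,\quad x_{i,A}\ge 0\quad \forall\, i\in A;\end{aligned}$$ the first family of constraints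 is absent for $k=0$ and the second is absent for $k=m$. Every feasible program among these attains its minimum, and at least one of them is feasible. -/

import Mathlib

open MeasureTheory

noncomputable section

/-- A marginal distribution model over the products `Fin n`: the deterministic utilities `ν i` and
the laws `μ i` of the random utility terms. Each law is absolutely continuous, has a finite first
moment, and its distribution function is strictly increasing on its support. -/
structure MDM (n : ℕ) where
  ν : Fin n → ℝ
  μ : Fin n → Measure ℝ
  isProbabilityMeasure : ∀ i, IsProbabilityMeasure (μ i)
  absolutelyContinuous : ∀ i, μ i ≪ volume
  strictMonoOn_cdf : ∀ i, StrictMonoOn (ProbabilityTheory.cdf (μ i)) (μ i).support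
  integrable : ∀ i, Integrable (fun t : ℝ => t) (μ i)

namespace MDM

variable {n : ℕ} (M : MDM n)

/-- All joint laws of the random utility terms with the given marginals. -/
def jointLaws : Set (Measure (Fin n → ℝ)) :=
  {θ | IsProbabilityMeasure θ ∧ ∀ i, θ.map (fun ε => ε i) = M.μ i}

/-- Expected utility of the best product of the (nonempty) assortment `S` under `θ`. -/
def expectedMaxUtility (S : Finset (Fin n)) (θ : Measure (Fin n → ℝ)) : ℝ :=
  ∫ ε, (⨆ i : {i // i ∈ S}, (M.ν i + ε i)) ∂θ

/-- `θ` attains the supremum of the expected maximal utility over all joint laws. -/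
def IsExtremal (S : Finset (Fin n)) (θ : Measure (Fin n → ℝ)) : Prop :=
  θ ∈ M.jointLaws ∧
    ∀ θ' ∈ M.jointLaws, M.expectedMaxUtility S θ' ≤ M.expectedMaxUtility S θ

/-- The event that product `i` maximizes the utility over the assortment `S`. -/
def argmaxEvent (S : Finset (Fin n)) (i : Fin n) : Set (Fin n → ℝ) :=
  {ε | ∀ j ∈ S, M.ν j + ε j ≤ M.ν i + ε i}

/-- The numbers `q i`, `i ∈ S`, are the choice probabilities of the model for the assortment `S`:
those of a joint law attaining the maximal expected utility. -/
def Generates (S : Finset (Fin n)) (q : Fin n → ℝ) : Prop :=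
  ∃ θ, M.IsExtremal S θ ∧ ∀ i ∈ S, q i = θ.real (M.argmaxEvent S i)

end MDM

/-- The probability simplex over `A`; only the coordinates in `A` matter. -/
def simplexOn {n : ℕ} (A : Finset (Fin n)) : Set (Fin n → ℝ) :=
  {x | (∀ i ∈ A, 0 ≤ x i) ∧ ∑ i ∈ A, x i = 1}

/-- The choice probability collections over the assortments in `𝒮` that are representable by one
marginal distribution model. The number `p S i` is the probability of choosing `i` from `S`; only
the values with `S ∈ 𝒮` and `i ∈ S` matter. -/
def mdmProbabilities {n : ℕ} (𝒮 : Finset (Finset (Fin n))) :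
    Set (Finset (Fin n) → Fin n → ℝ) :=
  {p | (∀ S ∈ 𝒮, p S ∈ simplexOn S) ∧ ∃ M : MDM n, ∀ S ∈ 𝒮, M.Generates S (p S)}

/-- The choice probability vectors for a new assortment `A` (not in `𝒮`) that are consistent with
the data `p` over `𝒮`. -/
def consistentSet {n : ℕ} (𝒮 : Finset (Finset (Fin n))) (p : Finset (Fin n) → Fin n → ℝ)
    (A : Finset (Fin n)) : Set (Fin n → ℝ) :=
  {x | Function.update p A x ∈ mdmProbabilities (insert A 𝒮)}

/-- Expected revenue `∑ i ∈ A, r i * x i`. -/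
def revenue {n : ℕ} (r : Fin n → ℝ) (A : Finset (Fin n)) (x : Fin n → ℝ) : ℝ :=
  ∑ i ∈ A, r i * x i

/-- Infimum of the expected revenue over a set `C`, equal to `+∞` when `C` is empty. -/
def infRevenue {n : ℕ} (r : Fin n → ℝ) (A : Finset (Fin n)) (C : Set (Fin n → ℝ)) : EReal :=
  ⨅ x ∈ C, ((revenue r A x : ℝ) : EReal)

/-- The worst-case expected revenue of `A` over all consistent choice probability vectors. -/
def worstCaseRevenue {n : ℕ} (𝒮 : Finset (Finset (Fin n))) (p : Finset (Fin n) → Fin n → ℝ)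
    (r : Fin n → ℝ) (A : Finset (Fin n)) : EReal :=
  infRevenue r A (consistentSet 𝒮 p A)

/-- `S 0 ⊂ S 1 ⊂ ⋯ ⊂ S (m - 1)` lists exactly the members of `𝒮` (so `m` is the size of `𝒮`). -/
def IsNestedEnumeration {n m : ℕ} (𝒮 : Finset (Finset (Fin n)))
    (S : Fin m → Finset (Fin n)) : Prop :=
  StrictMono S ∧ ∀ T, T ∈ 𝒮 ↔ ∃ j, S j = T

/-- The feasible region of the `k`-th linear program, `0 ≤ k ≤ m`. In the 1-based indexing
`S₁ ⊂ ⋯ ⊂ Sₘ` one has `S_j = S (j - 1)`: the first family of constraints is about `S_k` and is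
absent for `k = 0`, the second is about the members of `𝒮` containing `S_{k+1}` and is absent
for `k = m`. -/
def nestedFeasible {n m : ℕ} (𝒮 : Finset (Finset (Fin n))) (S : Fin m → Finset (Fin n))
    (p : Finset (Fin n) → Fin n → ℝ) (A : Finset (Fin n)) (k : Fin (m + 1)) :
    Set (Fin n → ℝ) :=
  {x | (∀ j : Fin m, (j : ℕ) + 1 = k → ∀ i ∈ A ∩ S j, x i ≤ p (S j) i) ∧
    (∀ j : Fin m, (j : ℕ) = k → ∀ T ∈ 𝒮, S j ⊆ T → ∀ i ∈ A ∩ T, p T i ≤ x i) ∧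
    x ∈ simplexOn A}

/-- The value of the `k`-th linear program (`+∞` if it is infeasible). -/
def nestedValue {n m : ℕ} (𝒮 : Finset (Finset (Fin n))) (S : Fin m → Finset (Fin n))
    (p : Finset (Fin n) → Fin n → ℝ) (r : Fin n → ℝ) (A : Finset (Fin n)) (k : Fin (m + 1)) :
    EReal :=
  infRevenue r A (nestedFeasible 𝒮 S p A k)

end

/-!
Bounding the maximal utility by `l + ∑ max (utility - l) 0` gives, for every level `l`, an upper
bound on the expected maximal utility that depends on the marginals only. If the probabilities that
the products exceed the level `l` add up to one, a coupling under which exactly one product exceeds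
`l` attains the bound, and under every optimal coupling the chosen product is the one exceeding `l`.
Hence choice probabilities are exceedance probabilities at a common level, which grows with the
assortment. A new assortment therefore has its level between those of two consecutive members of the
nested family, which gives the constraints of one of the linear programs. Conversely, a solution of
such a program is approximated by moving, for each product separately, the right quantile of its
utility to a new level by a bilipschitz change of scale that fixes the levels of the given
assortments. So the regions of the linear programs together form the closure of the set of
consistent choice probabilities.
-/

section FiniteMaximum

variable {ι : Type*} {S : Finset ι} (u : ι → ℝ) (l : ℝ)

theorem iSup_le_add_sum_max_sub (hS : S.Nonempty) :
    (⨆ i : {i // i ∈ S}, u i) ≤ l + ∑ i ∈ S, max (u i - l) 0 := by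
  have : Nonempty {i // i ∈ S} := hS.to_subtype
  refine ciSup_le fun i => ?_
  have h := Finset.single_le_sum (f := fun j => max (u j - l) 0) (fun _ _ => le_max_right _ _) i.2
  linarith [le_max_left (u i - l) 0]

theorem iSup_eq_add_sum_max_sub_iff (hS : S.Nonempty) :
    (⨆ i : {i // i ∈ S}, u i) = l + ∑ i ∈ S, max (u i - l) 0 ↔
      ∃ k ∈ S, l ≤ u k ∧ ∀ j ∈ S, j ≠ k → u j ≤ l := by
  classical
  constructor
  · intro h
    have : Nonempty {i // i ∈ S} := hS.to_subtype
    obtain ⟨⟨k, hk⟩, hmax⟩ := exists_eq_ciSup_of_finite (f := fun i : {i // i ∈ S} => u i)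
    have hrest : 0 ≤ ∑ i ∈ S.erase k, max (u i - l) 0 :=
      Finset.sum_nonneg fun _ _ => le_max_right _ _
    rw [← hmax, ← Finset.add_sum_erase _ _ hk] at h
    refine ⟨k, hk, ?_, fun j hj hjk => ?_⟩
    · linarith [le_max_right (u k - l) 0]
    · have hj := Finset.single_le_sum (f := fun i => max (u i - l) 0)
        (fun _ _ => le_max_right _ _) (Finset.mem_erase.2 ⟨hjk, hj⟩)
      linarith [le_max_left (u k - l) 0, le_max_left (u j - l) 0]
  · rintro ⟨k, hk, hlk, hle⟩
    refine le_antisymm (iSup_le_add_sum_max_sub u l hS) ?_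
    rw [Finset.sum_eq_single_of_mem k hk fun j hj hjk => max_eq_right (sub_nonpos.2 (hle j hj hjk)),
      max_eq_left (sub_nonneg.2 hlk), add_sub_cancel]
    exact le_ciSup (f := fun i : {i // i ∈ S} => u i) (Set.finite_range _).bddAbove ⟨k, hk⟩

end FiniteMaximum

theorem abs_sub_le_abs_sum_sub {ι : Type*} {S : Finset ι} {f g : ι → ℝ}
    (h : (∀ i ∈ S, f i ≤ g i) ∨ ∀ i ∈ S, g i ≤ f i) {i : ι} (hi : i ∈ S) :
    |f i - g i| ≤ |∑ j ∈ S, f j - ∑ j ∈ S, g j| := by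
  wlog hfg : ∀ i ∈ S, g i ≤ f i generalizing f g
  · rw [abs_sub_comm, abs_sub_comm (∑ j ∈ S, f j)]
    exact this h.symm (h.resolve_right hfg)
  have hn : ∀ j ∈ S, 0 ≤ f j - g j := fun j hj => sub_nonneg.2 (hfg j hj)
  rw [← Finset.sum_sub_distrib, abs_of_nonneg (hn i hi), abs_of_nonneg (Finset.sum_nonneg hn)]
  exact Finset.single_le_sum hn hi

theorem continuous_measureReal_setOf_lt {Ω α : Type*} [MeasurableSpace Ω] {μ : Measure Ω}
    [IsFiniteMeasure μ] [LinearOrder α] [TopologicalSpace α] [OrderTopology α]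
    [FirstCountableTopology α] {f : Ω → α} (hf : ∀ a, MeasurableSet {ω | a < f ω})
    (hne : ∀ a, ∀ᵐ ω ∂μ, f ω ≠ a) : Continuous fun a => μ.real {ω | a < f ω} := by
  have hint : (fun a => μ.real {ω | a < f ω}) =
      fun a => ∫ ω, {ω | a < f ω}.indicator (fun _ => (1 : ℝ)) ω ∂μ := by
    funext a
    rw [integral_indicator (hf a), setIntegral_const, smul_eq_mul, mul_one]
  rw [hint, continuous_iff_continuousAt]
  intro a
  refine continuousAt_of_dominated (bound := fun _ => 1)
    (.of_forall fun b => (measurable_const.indicator (hf b)).aestronglyMeasurable)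
    (.of_forall fun b => .of_forall fun ω => ?_) (integrable_const _) ?_
  · exact norm_indicator_le_norm_self (fun _ => (1 : ℝ)) ω |>.trans norm_one.le
  filter_upwards [hne a] with ω hω
  rcases lt_or_gt_of_ne hω with h | h
  · refine (continuousAt_const (y := (0 : ℝ))).congr ?_
    filter_upwards [lt_mem_nhds h] with b hb
    exact (Set.indicator_of_notMem (s := {ω | b < f ω}) hb.not_gt (fun _ => (1 : ℝ))).symm
  · refine (continuousAt_const (y := (1 : ℝ))).congr ?_
    filter_upwards [gt_mem_nhds h] with b hb
    exact (Set.indicator_of_mem (s := {ω | b < f ω}) hb (fun _ => (1 : ℝ))).symm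

/-! ### Couplings with exclusive events -/

section ExclusiveCoupling

open ProbabilityTheory

variable {ι : Type*} [Fintype ι] [DecidableEq ι] {X : ι → Type*} [∀ i, MeasurableSpace (X i)]
  (μ : ∀ i, Measure (X i)) (E : ∀ i, Set (X i))

/-- The law of the `j`-th coordinate under which `E j` occurs if and only if `j = i`. -/
noncomputable def exclusiveMarginal (i j : ι) : Measure (X j) :=
  if j = i then (μ j)[|E j] else (μ j)[|(E j)ᶜ]

/-- The mixture, over `i` with weights `μ i (E i)`, of the product laws under which `E i` is the
only event that occurs. It is a coupling of the `μ i` when the weights add up to one. -/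
noncomputable def exclusiveCoupling : Measure (∀ i, X i) :=
  ∑ i, μ i (E i) • Measure.pi (exclusiveMarginal μ E i)

variable {μ E} [∀ i, IsProbabilityMeasure (μ i)]

theorem sum_erase_measure_eq_measure_compl (hE : ∀ i, MeasurableSet (E i))
    (h : ∑ i, μ i (E i) = 1) (j : ι) :
    ∑ i ∈ Finset.univ.erase j, μ i (E i) = μ j (E j)ᶜ := by
  rw [← Finset.add_sum_erase _ _ (Finset.mem_univ j), ← prob_add_prob_compl (μ := μ j) (hE j)] at h
  exact (ENNReal.add_right_inj (measure_ne_top _ _)).1 h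

theorem isProbabilityMeasure_exclusiveMarginal (hE : ∀ i, MeasurableSet (E i))
    (h : ∑ i, μ i (E i) = 1) {i : ι} (hi : μ i (E i) ≠ 0) (j : ι) :
    IsProbabilityMeasure (exclusiveMarginal μ E i j) := by
  rw [exclusiveMarginal]
  split_ifs with hji
  · subst hji
    exact cond_isProbabilityMeasure hi
  · refine cond_isProbabilityMeasure fun h0 => hi ?_
    rw [← sum_erase_measure_eq_measure_compl hE h] at h0
    exact Finset.sum_eq_zero_iff.1 h0 i (Finset.mem_erase.2 ⟨Ne.symm hji, Finset.mem_univ i⟩)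

theorem exclusiveCoupling_map_eval (hE : ∀ i, MeasurableSet (E i)) (h : ∑ i, μ i (E i) = 1)
    (j : ι) : (exclusiveCoupling μ E).map (fun ω => ω j) = μ j := by
  have hcomponent : ∀ i, (μ i (E i) • Measure.pi (exclusiveMarginal μ E i)).map (fun ω => ω j) =
      μ i (E i) • exclusiveMarginal μ E i j := by
    intro i
    by_cases hi : μ i (E i) = 0
    · rw [hi, zero_smul, zero_smul, Measure.map_zero]
    · have := isProbabilityMeasure_exclusiveMarginal hE h hi
      rw [Measure.map_smul, (measurePreserving_eval (exclusiveMarginal μ E i) j).map_eq]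
  have hself : exclusiveMarginal μ E j j = (μ j)[|E j] := if_pos rfl
  have hothers : ∀ i ∈ Finset.univ.erase j,
      μ i (E i) • exclusiveMarginal μ E i j = μ i (E i) • (μ j)[|(E j)ᶜ] :=
    fun i hi => by rw [exclusiveMarginal, if_neg (Finset.ne_of_mem_erase hi).symm]
  rw [exclusiveCoupling, Measure.map_finset_sum (measurable_pi_apply j).aemeasurable,
    Finset.sum_congr rfl fun i _ => hcomponent i, ← Finset.add_sum_erase _ _ (Finset.mem_univ j),
    hself, Finset.sum_congr rfl hothers, ← Finset.sum_smul,
    sum_erase_measure_eq_measure_compl hE h]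
  ext s -
  rw [Measure.add_apply, Measure.smul_apply, Measure.smul_apply, smul_eq_mul, smul_eq_mul, mul_comm,
    cond_mul_eq_inter (hE j), mul_comm, cond_mul_eq_inter (hE j).compl, Set.inter_comm,
    Set.inter_comm _ s]
  exact measure_inter_add_sdiff s (hE j)

theorem ae_exclusiveCoupling_existsUnique (hE : ∀ i, MeasurableSet (E i))
    (h : ∑ i, μ i (E i) = 1) : ∀ᵐ ω ∂exclusiveCoupling μ E, ∃! i, ω i ∈ E i := by
  rw [exclusiveCoupling, ae_finsetSum_measure_iff]
  intro i _
  by_cases hi : μ i (E i) = 0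
  · simp only [hi, zero_smul, ae_zero, Filter.eventually_bot]
  refine Measure.ae_smul_measure ?_ _
  have := isProbabilityMeasure_exclusiveMarginal hE h hi
  have hmem : ∀ j, ∀ᵐ t ∂exclusiveMarginal μ E i j, t ∈ E j ↔ j = i := by
    intro j
    rw [exclusiveMarginal]
    split_ifs with hji
    · filter_upwards [ae_cond_mem (hE j)] with t ht using iff_of_true ht hji
    · filter_upwards [ae_cond_mem (hE j).compl] with t ht using iff_of_false ht hji
  filter_upwards [ae_all_iff.2 fun j =>
    (measurePreserving_eval _ j).quasiMeasurePreserving.ae (hmem j)] with ω hω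
  exact ⟨i, (hω i).2 rfl, fun j hj => (hω j).1 hj⟩

end ExclusiveCoupling

/-! ### Bilipschitz changes of scale -/

/-- An increasing homeomorphism of the line that is Lipschitz in both directions: the changes of
scale that preserve absolute continuity and finite first moments of laws. -/
def IsBilipschitz (e : ℝ ≃o ℝ) : Prop :=
  (∃ K, LipschitzWith K e) ∧ ∃ K, LipschitzWith K e.symm

theorem isBilipschitz_refl : IsBilipschitz (OrderIso.refl ℝ) :=
  ⟨⟨1, LipschitzWith.id⟩, ⟨1, LipschitzWith.id⟩⟩

theorem IsBilipschitz.trans {e e' : ℝ ≃o ℝ} (he : IsBilipschitz e) (he' : IsBilipschitz e') :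
    IsBilipschitz (e.trans e') := by
  obtain ⟨⟨K, hK⟩, L, hL⟩ := he
  obtain ⟨⟨K', hK'⟩, L', hL'⟩ := he'
  exact ⟨⟨_, hK'.comp hK⟩, _, hL.comp hL'⟩

theorem isBilipschitz_addLeft (a : ℝ) : IsBilipschitz (OrderIso.addLeft a) :=
  ⟨⟨1, (isometry_add_left a).lipschitz⟩, 1, (isometry_add_left (-a)).lipschitz⟩

theorem exists_isBilipschitz_of_slopes {f : ℝ → ℝ} {c K : ℝ} (hc : 0 < c)
    (h : ∀ x y, x ≤ y → c * (y - x) ≤ f y - f x ∧ f y - f x ≤ K * (y - x)) :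
    ∃ e : ℝ ≃o ℝ, ⇑e = f ∧ IsBilipschitz e := by
  have hK : 0 ≤ K := by linarith [h 0 1 zero_le_one]
  have hmono : StrictMono f := fun x y hxy => by
    linarith [(h x y hxy.le).1, mul_pos hc (sub_pos.2 hxy)]
  have hdist : ∀ x y, c * dist x y ≤ dist (f x) (f y) ∧ dist (f x) (f y) ≤ K * dist x y := by
    intro x y
    wlog hxy : y ≤ x generalizing x y
    · simpa only [dist_comm] using this y x (le_of_not_ge hxy)
    rw [Real.dist_eq, Real.dist_eq, abs_of_nonneg (sub_nonneg.2 hxy),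
      abs_of_nonneg (sub_nonneg.2 (hmono.monotone hxy))]
    exact h y x hxy
  have hlip : LipschitzWith K.toNNReal f := .of_dist_le_mul fun x y => by
    rw [Real.coe_toNNReal K hK]
    exact (hdist x y).2
  have hsurj : Function.Surjective f := by
    intro z
    set R := |z - f 0| / c
    have hcR : c * R = |z - f 0| := mul_div_cancel₀ _ hc.ne'
    have hR0 : 0 ≤ R := div_nonneg (abs_nonneg _) hc.le
    refine mem_range_of_exists_le_of_exists_ge hlip.continuous ⟨-R, ?_⟩ ⟨R, ?_⟩
    · linarith [(h (-R) 0 (neg_nonpos.2 hR0)).1, neg_abs_le (z - f 0)]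
    · linarith [(h 0 R hR0).1, le_abs_self (z - f 0)]
  let e := hmono.orderIsoOfSurjective f hsurj
  refine ⟨e, rfl, ⟨_, hlip⟩, ⟨c⁻¹.toNNReal, .of_dist_le_mul fun x y => ?_⟩⟩
  rw [Real.coe_toNNReal _ (inv_nonneg.2 hc.le), inv_mul_eq_div, le_div_iff₀ hc, mul_comm]
  have := (hdist (e.symm x) (e.symm y)).1
  rwa [show f (e.symm x) = x from e.apply_symm_apply x,
    show f (e.symm y) = y from e.apply_symm_apply y] at this

/-- The function that vanishes outside `(a, b)`, leaves `a` with slope `u` and reaches `b` with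
slope `-v`. -/
def tent (a b u v y : ℝ) : ℝ := max 0 (min (u * (y - a)) (v * (b - y)))

theorem tent_eq_zero {a b u v y : ℝ} (hu : 0 ≤ u) (hv : 0 ≤ v) (hy : y ∉ Set.Ioo a b) :
    tent a b u v y = 0 := by
  refine max_eq_left ?_
  rcases le_or_gt y a with hya | hay
  · exact min_le_of_left_le (mul_nonpos_of_nonneg_of_nonpos hu (sub_nonpos.2 hya))
  · exact min_le_of_right_le (mul_nonpos_of_nonneg_of_nonpos hv
      (sub_nonpos.2 (not_lt.1 fun hyb => hy ⟨hay, hyb⟩)))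

theorem tent_sub_tent_mem_Icc {a b u v x y : ℝ} (hu : 0 ≤ u) (hv : 0 ≤ v) (hxy : x ≤ y) :
    tent a b u v y - tent a b u v x ∈ Set.Icc (-(v * (y - x))) (u * (y - x)) := by
  have hux : 0 ≤ u * (y - x) := mul_nonneg hu (sub_nonneg.2 hxy)
  have hvx : 0 ≤ v * (y - x) := mul_nonneg hv (sub_nonneg.2 hxy)
  simp only [tent, Set.mem_Icc]
  constructor
  · rw [neg_le_sub_iff_le_add, ← max_add_add_right, ← min_add_add_right]
    refine max_le_max (by linarith) (min_le_min ?_ ?_) <;> linarith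
  · rw [sub_le_iff_le_add', ← max_add_add_right, ← min_add_add_right]
    refine max_le_max (by linarith) (min_le_min ?_ ?_) <;> linarith

theorem exists_isBilipschitz_apply_eq {a b s t : ℝ} (ht : t ∈ Set.Ioo a b) (hs : s ∈ Set.Ioo a b) :
    ∃ e : ℝ ≃o ℝ, IsBilipschitz e ∧ e t = s ∧ ∀ y ∉ Set.Ioo a b, e y = y := by
  have hta : 0 < t - a := sub_pos.2 ht.1
  have hbt : 0 < b - t := sub_pos.2 ht.2
  set u := (t - a)⁻¹
  set v := (b - t)⁻¹
  have hu : u * (t - a) = 1 := inv_mul_cancel₀ hta.ne'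
  have hv : v * (b - t) = 1 := inv_mul_cancel₀ hbt.ne'
  have hu0 : 0 < u := inv_pos.2 hta
  have hv0 : 0 < v := inv_pos.2 hbt
  have hleft : 0 < 1 + (s - t) * u := by
    rw [show 1 + (s - t) * u = u * (s - a) by linear_combination (-1) * hu]
    exact mul_pos hu0 (sub_pos.2 hs.1)
  have hright : 0 < 1 - (s - t) * v := by
    rw [show 1 - (s - t) * v = v * (b - s) by linear_combination (-1) * hv]
    exact mul_pos hv0 (sub_pos.2 hs.2)
  have hslopes : ∀ x y, x ≤ y →
      min (1 + (s - t) * u) (1 - (s - t) * v) * (y - x) ≤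
        y + (s - t) * tent a b u v y - (x + (s - t) * tent a b u v x) ∧
      y + (s - t) * tent a b u v y - (x + (s - t) * tent a b u v x) ≤
        max (1 + (s - t) * u) (1 - (s - t) * v) * (y - x) := by
    intro x y hxy
    obtain ⟨hlower, hupper⟩ := tent_sub_tent_mem_Icc (a := a) (b := b) hu0.le hv0.le hxy
    rw [min_mul_of_nonneg _ _ (sub_nonneg.2 hxy), max_mul_of_nonneg _ _ (sub_nonneg.2 hxy)]
    rcases le_total s t with hst | hst
    · refine ⟨min_le_of_left_le ?_, le_max_of_le_right ?_⟩ <;>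
        linarith [mul_le_mul_of_nonpos_left hlower (sub_nonpos.2 hst),
          mul_le_mul_of_nonpos_left hupper (sub_nonpos.2 hst)]
    · refine ⟨min_le_of_right_le ?_, le_max_of_le_left ?_⟩ <;>
        linarith [mul_le_mul_of_nonneg_left hlower (sub_nonneg.2 hst),
          mul_le_mul_of_nonneg_left hupper (sub_nonneg.2 hst)]
  obtain ⟨e, he, hbi⟩ := exists_isBilipschitz_of_slopes (lt_min hleft hright) hslopes
  refine ⟨e, hbi, ?_, fun y hy => ?_⟩ <;> simp only [he]
  · rw [tent, hu, hv, min_self, max_eq_right zero_le_one]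
    ring
  · rw [tent_eq_zero hu0.le hv0.le hy, mul_zero, add_zero]

theorem exists_real_mem_Ioo_abs_sub_lt {f : EReal → ℝ} (hf : Continuous f) {a b : EReal}
    (hab : a < b) {x : ℝ} (hx : x ∈ Set.Icc (f b) (f a)) {δ : ℝ} (hδ : 0 < δ) :
    ∃ t : ℝ, (t : EReal) ∈ Set.Ioo a b ∧ |f t - x| < δ := by
  obtain ⟨c, hc, rfl⟩ := intermediate_value_Icc' hab.le hf.continuousOn hx
  rw [← closure_Ioo hab.ne, mem_closure_iff] at hc
  obtain ⟨t, ht, htab⟩ := hc {t | |f t - f c| < δ}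
    (isOpen_lt (by fun_prop) continuous_const) (by simpa using hδ)
  lift t to ℝ using ⟨htab.2.ne_top, htab.1.ne_bot⟩
  exact ⟨t, htab, ht⟩

theorem exists_isBilipschitz_apply_eq_of_ereal {a b : EReal} {s t : ℝ}
    (ht : (t : EReal) ∈ Set.Ioo a b) (hs : (s : EReal) ∈ Set.Ioo a b) :
    ∃ e : ℝ ≃o ℝ, IsBilipschitz e ∧ e t = s ∧ ∀ y : ℝ, (y : EReal) ∉ Set.Ioo a b → e y = y := by
  obtain ⟨a', ha, ha'⟩ := EReal.lt_iff_exists_real_btwn.1 (lt_min ht.1 hs.1)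
  obtain ⟨b', hb', hb⟩ := EReal.lt_iff_exists_real_btwn.1 (max_lt ht.2 hs.2)
  rw [lt_min_iff, EReal.coe_lt_coe_iff, EReal.coe_lt_coe_iff] at ha'
  rw [max_lt_iff, EReal.coe_lt_coe_iff, EReal.coe_lt_coe_iff] at hb'
  obtain ⟨e, he, hts, hfix⟩ := exists_isBilipschitz_apply_eq ⟨ha'.1, hb'.1⟩ ⟨ha'.2, hb'.2⟩
  exact ⟨e, he, hts, fun y hy => hfix y fun hy' =>
    hy ⟨ha.trans (EReal.coe_lt_coe_iff.2 hy'.1), (EReal.coe_lt_coe_iff.2 hy'.2).trans hb⟩⟩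

theorem exists_isBilipschitz_abs_symm_apply_sub_lt {f : EReal → ℝ} (hf : Continuous f)
    {Λ : Finset EReal} {s x : ℝ} (hs : (s : EReal) ∉ Λ) (hx : x ∈ Set.Icc (f ⊤) (f ⊥))
    (hlt : ∀ l ∈ Λ, l < s → x ≤ f l) (hgt : ∀ l ∈ Λ, s < l → f l ≤ x) {δ : ℝ} (hδ : 0 < δ) :
    ∃ e : ℝ ≃o ℝ, IsBilipschitz e ∧ (∀ y : ℝ, (y : EReal) ∈ Λ → e y = y) ∧
      |f (e.symm s : ℝ) - x| < δ := by
  set a := (Λ.filter (· < (s : EReal))).sup id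
  set b := (Λ.filter ((s : EReal) < ·)).inf id
  have has : a < s :=
    (Finset.sup_lt_iff (EReal.bot_lt_coe s)).2 fun l hl => (Finset.mem_filter.1 hl).2
  have hsb : s < b :=
    (Finset.lt_inf_iff (EReal.coe_lt_top s)).2 fun l hl => (Finset.mem_filter.1 hl).2
  have hxa : x ≤ f a := Finset.sup_induction (p := fun l => x ≤ f l) hx.2
    (fun l hl l' hl' => by rcases max_choice l l' with h | h <;> rwa [h])
    fun l hl => hlt l (Finset.mem_filter.1 hl).1 (Finset.mem_filter.1 hl).2
  have hbx : f b ≤ x := Finset.inf_induction (p := fun l => f l ≤ x) hx.1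
    (fun l hl l' hl' => by rcases min_choice l l' with h | h <;> rwa [h])
    fun l hl => hgt l (Finset.mem_filter.1 hl).1 (Finset.mem_filter.1 hl).2
  obtain ⟨t, ht, htx⟩ := exists_real_mem_Ioo_abs_sub_lt hf (has.trans hsb) ⟨hbx, hxa⟩ hδ
  obtain ⟨e, he, hts, hfix⟩ := exists_isBilipschitz_apply_eq_of_ereal ht ⟨has, hsb⟩
  refine ⟨e, he, fun y hy => hfix y fun hyab => ?_, by rwa [← hts, e.symm_apply_apply]⟩
  rcases lt_trichotomy (y : EReal) s with h | h | h
  · exact hyab.1.not_ge (Finset.le_sup (f := id) (Finset.mem_filter.2 ⟨hy, h⟩))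
  · exact hs (h ▸ hy)
  · exact hyab.2.not_ge (Finset.inf_le (f := id) (Finset.mem_filter.2 ⟨hy, h⟩))

theorem IsBilipschitz.volume_preimage_eq_zero {e : ℝ ≃o ℝ} (he : IsBilipschitz e) {s : Set ℝ}
    (hs : volume s = 0) : volume (e ⁻¹' s) = 0 := by
  obtain ⟨-, K, hK⟩ := he
  have h := hK.hausdorffMeasure_image_le zero_le_one s
  rw [hausdorffMeasure_real, hs, mul_zero, nonpos_iff_eq_zero] at h
  rwa [e.symm.image_eq_preimage_symm, OrderIso.symm_symm] at h

theorem integrable_comp_of_lipschitzWith {Ω : Type*} [MeasurableSpace Ω] {μ : Measure Ω}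
    [IsFiniteMeasure μ] {E F : Type*} [NormedAddCommGroup E] [NormedAddCommGroup F] {f : E → F}
    {K : NNReal} (hf : LipschitzWith K f) {g : Ω → E} (hg : Integrable g μ) :
    Integrable (fun ω => f (g ω)) μ := by
  refine Integrable.mono' ((integrable_const ‖f 0‖).add (hg.norm.const_mul K))
    (hf.continuous.comp_aestronglyMeasurable hg.1) (.of_forall fun ω => ?_)
  have h := hf.norm_sub_le (g ω) 0
  rw [sub_zero] at h
  exact (norm_le_norm_add_norm_sub' _ _).trans (add_le_add_right h _)

theorem cdf_map_orderIso (μ : Measure ℝ) [IsProbabilityMeasure μ] (e : ℝ ≃o ℝ) (x : ℝ) :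
    ProbabilityTheory.cdf (μ.map e) x = ProbabilityTheory.cdf μ (e.symm x) := by
  have hm : Measurable e := e.continuous.measurable
  have := Measure.isProbabilityMeasure_map (μ := μ) hm.aemeasurable
  rw [ProbabilityTheory.cdf_eq_real, ProbabilityTheory.cdf_eq_real,
    map_measureReal_apply hm measurableSet_Iic, e.preimage_Iic]

theorem mem_support_of_mem_support_map {X Y : Type*} [TopologicalSpace X] [MeasurableSpace X]
    [BorelSpace X] [TopologicalSpace Y] [MeasurableSpace Y] [BorelSpace Y] {μ : Measure X}
    (e : X ≃ₜ Y) {y : Y} (hy : y ∈ (μ.map e).support) : e.symm y ∈ μ.support := by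
  rw [Measure.mem_support_iff_forall] at hy ⊢
  intro U hU
  have h := hy (e.symm ⁻¹' U) (e.symm.continuous.continuousAt hU)
  rwa [e.measurableEmbedding.map_apply, ← Set.preimage_comp, e.symm_comp_self,
    Set.preimage_id] at h

theorem strictMonoOn_cdf_map_orderIso {μ : Measure ℝ} [IsProbabilityMeasure μ]
    (h : StrictMonoOn (ProbabilityTheory.cdf μ) μ.support) (e : ℝ ≃o ℝ) :
    StrictMonoOn (ProbabilityTheory.cdf (μ.map e)) (μ.map e).support := by
  intro x hx y hy hxy
  rw [cdf_map_orderIso, cdf_map_orderIso]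
  exact h (mem_support_of_mem_support_map e.toHomeomorph hx)
    (mem_support_of_mem_support_map e.toHomeomorph hy) (e.symm.strictMono hxy)

/-! ### Duality and choice probabilities -/

namespace MDM

variable {n : ℕ} (M : MDM n)

instance (i : Fin n) : IsProbabilityMeasure (M.μ i) :=
  M.isProbabilityMeasure i

/-- The random terms for which the utility of product `i` exceeds the level `l`. -/
def exceedSet (i : Fin n) (l : EReal) : Set ℝ :=
  {t | l < ((M.ν i + t : ℝ) : EReal)}

/-- The probability that the utility of product `i` exceeds `l`. Levels are extended reals, so that
the values of this function fill the whole interval `[0, 1]`. -/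
noncomputable def exceedProb (i : Fin n) (l : EReal) : ℝ :=
  (M.μ i).real (M.exceedSet i l)

theorem measurableSet_exceedSet (i : Fin n) (l : EReal) : MeasurableSet (M.exceedSet i l) :=
  measurableSet_lt measurable_const (by fun_prop)

theorem exceedProb_nonneg (i : Fin n) (l : EReal) : 0 ≤ M.exceedProb i l :=
  measureReal_nonneg

theorem exceedProb_bot (i : Fin n) : M.exceedProb i ⊥ = 1 := by
  have huniv : M.exceedSet i ⊥ = Set.univ := Set.eq_univ_of_forall fun t => EReal.bot_lt_coe _
  rw [exceedProb, huniv, probReal_univ]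

theorem exceedProb_top (i : Fin n) : M.exceedProb i ⊤ = 0 := by
  have hempty : M.exceedSet i ⊤ = ∅ :=
    Set.eq_empty_of_forall_notMem fun t (ht : ⊤ < ((M.ν i + t : ℝ) : EReal)) => not_top_lt ht
  rw [exceedProb, hempty, measureReal_empty]

theorem antitone_exceedProb (i : Fin n) : Antitone (M.exceedProb i) :=
  fun _ _ h => measureReal_mono fun _ ht => lt_of_le_of_lt h ht

theorem ae_utility_ne (i : Fin n) (l : ℝ) : ∀ᵐ t ∂M.μ i, M.ν i + t ≠ l := by
  filter_upwards [(M.absolutelyContinuous i).ae_le (Measure.ae_ne volume (l - M.ν i))] with t ht h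
  exact ht (eq_sub_of_add_eq' h)

theorem continuous_exceedProb (i : Fin n) : Continuous (M.exceedProb i) := by
  refine continuous_measureReal_setOf_lt (M.measurableSet_exceedSet i) fun l => ?_
  filter_upwards [M.ae_utility_ne i l.toReal] with t ht h
  exact ht (by rw [← h, EReal.toReal_coe])

section Duality

variable {M} {S : Finset (Fin n)} {θ : Measure (Fin n → ℝ)}

theorem measurePreserving_of_mem_jointLaws (h : θ ∈ M.jointLaws) (i : Fin n) :
    MeasurePreserving (fun ε => ε i) θ (M.μ i) :=
  ⟨measurable_pi_apply i, h.2 i⟩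

theorem integrable_utility (h : θ ∈ M.jointLaws) (i : Fin n) :
    Integrable (fun ε : Fin n → ℝ => M.ν i + ε i) θ :=
  have := h.1
  (integrable_const _).add
    ((measurePreserving_of_mem_jointLaws h i).integrable_comp_of_integrable (M.integrable i))

theorem integrable_iSup_utility (h : θ ∈ M.jointLaws) (S : Finset (Fin n)) :
    Integrable (fun ε : Fin n → ℝ => ⨆ i : {i // i ∈ S}, (M.ν i + ε i)) θ := by
  rcases isEmpty_or_nonempty {i // i ∈ S} with hS | hS
  · have := h.1
    simp only [Real.iSup_of_isEmpty, integrable_const]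
  refine Integrable.mono' (g := fun ε => ∑ i ∈ S, |M.ν i + ε i|)
    (integrable_finsetSum _ fun i _ => (integrable_utility h i).abs)
    (Measurable.iSup fun i => by fun_prop).aestronglyMeasurable (.of_forall fun ε => ?_)
  obtain ⟨k, hk⟩ := exists_eq_ciSup_of_finite (f := fun i : {i // i ∈ S} => M.ν i + ε i)
  rw [← hk, Real.norm_eq_abs]
  exact Finset.single_le_sum (f := fun i => |M.ν i + ε i|) (fun _ _ => abs_nonneg _) k.2

/-- The objective of the problem dual to the maximization of the expected maximal utility over the
joint laws. -/
noncomputable def dualBound (M : MDM n) (S : Finset (Fin n)) (l : ℝ) : ℝ :=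
  l + ∑ i ∈ S, ∫ t, max (M.ν i + t - l) 0 ∂M.μ i

theorem integrable_add_sum_excess (h : θ ∈ M.jointLaws) (S : Finset (Fin n)) (l : ℝ) :
    Integrable (fun ε : Fin n → ℝ => l + ∑ i ∈ S, max (M.ν i + ε i - l) 0) θ :=
  have := h.1
  (integrable_const l).add (integrable_finsetSum _ fun i _ =>
    ((integrable_utility h i).sub (integrable_const l)).pos_part)

theorem integral_add_sum_excess (h : θ ∈ M.jointLaws) (S : Finset (Fin n)) (l : ℝ) :
    ∫ ε, (l + ∑ i ∈ S, max (M.ν i + ε i - l) 0) ∂θ = M.dualBound S l := by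
  have := h.1
  have hint : ∀ i ∈ S, Integrable (fun ε : Fin n → ℝ => max (M.ν i + ε i - l) 0) θ :=
    fun i _ => ((integrable_utility h i).sub (integrable_const l)).pos_part
  rw [integral_add (integrable_const l) (integrable_finsetSum _ hint), integral_finsetSum _ hint,
    integral_const, probReal_univ, one_smul, dualBound]
  congr 1
  refine Finset.sum_congr rfl fun i _ => ?_
  rw [← h.2 i, integral_map (measurable_pi_apply i).aemeasurable (by fun_prop)]

theorem expectedMaxUtility_le_dualBound (h : θ ∈ M.jointLaws) (hS : S.Nonempty) (l : ℝ) :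
    M.expectedMaxUtility S θ ≤ M.dualBound S l := by
  rw [← integral_add_sum_excess h S l]
  exact integral_mono (integrable_iSup_utility h S) (integrable_add_sum_excess h S l)
    fun ε => iSup_le_add_sum_max_sub (fun i => M.ν i + ε i) l hS

theorem expectedMaxUtility_eq_dualBound_iff (h : θ ∈ M.jointLaws) (hS : S.Nonempty) (l : ℝ) :
    M.expectedMaxUtility S θ = M.dualBound S l ↔
      ∀ᵐ ε ∂θ, ∃ k ∈ S, l ≤ M.ν k + ε k ∧ ∀ j ∈ S, j ≠ k → M.ν j + ε j ≤ l := by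
  rw [← integral_add_sum_excess h S l, expectedMaxUtility,
    integral_eq_iff_of_ae_le (integrable_iSup_utility h S) (integrable_add_sum_excess h S l)
      (.of_forall fun ε => iSup_le_add_sum_max_sub (fun i => M.ν i + ε i) l hS)]
  exact Filter.eventually_congr
    (.of_forall fun ε => iSup_eq_add_sum_max_sub_iff (fun i => M.ν i + ε i) l hS)

theorem measureReal_argmaxEvent_of_eq_dualBound (h : θ ∈ M.jointLaws) {l : ℝ}
    (heq : M.expectedMaxUtility S θ = M.dualBound S l) {i : Fin n} (hi : i ∈ S) :
    θ.real (M.argmaxEvent S i) = M.exceedProb i l := by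
  have hpreserving := measurePreserving_of_mem_jointLaws h
  rw [exceedProb, ← (hpreserving i).measureReal_preimage
    (M.measurableSet_exceedSet i l).nullMeasurableSet]
  refine measureReal_congr (Filter.eventuallyEq_set.2 ?_)
  filter_upwards [(expectedMaxUtility_eq_dualBound_iff h ⟨i, hi⟩ l).1 heq,
    ae_all_iff.2 fun j => (hpreserving j).quasiMeasurePreserving.ae (M.ae_utility_ne j l)]
    with ε ⟨k, hk, hlk, hle⟩ hne
  rw [Set.mem_preimage, exceedSet, Set.mem_ofPred_eq, EReal.coe_lt_coe_iff]
  refine ⟨fun hmax => lt_of_le_of_ne (hlk.trans (hmax k hk)) (hne i).symm, fun hli j hj => ?_⟩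
  obtain rfl : i = k := by_contra fun hik => hli.not_ge (hle i hi hik)
  rcases eq_or_ne j i with rfl | hji
  · exact le_rfl
  · exact (hle j hj hji).trans hli.le

theorem exists_expectedMaxUtility_eq_dualBound {l : ℝ} (hl : ∑ i ∈ S, M.exceedProb i l = 1) :
    ∃ θ ∈ M.jointLaws, M.expectedMaxUtility S θ = M.dualBound S l := by
  have hS : S.Nonempty := Finset.nonempty_of_sum_ne_zero (hl.trans_ne one_ne_zero)
  set E : Fin n → Set ℝ := fun i => if i ∈ S then M.exceedSet i l else ∅ with hE
  have hmeas : ∀ i, MeasurableSet (E i) := fun i => by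
    simp only [hE]
    split_ifs
    exacts [M.measurableSet_exceedSet i l, .empty]
  have hsum : ∑ i, M.μ i (E i) = 1 := by
    simp only [hE, apply_ite, measure_empty, Finset.sum_ite_mem, Finset.univ_inter]
    rw [← ENNReal.toReal_eq_one_iff, ENNReal.toReal_sum fun i _ => measure_ne_top _ _]
    exact hl
  have hmap := exclusiveCoupling_map_eval hmeas hsum
  have hlaw : exclusiveCoupling M.μ E ∈ M.jointLaws := by
    refine ⟨?_, hmap⟩
    obtain ⟨i, -⟩ := hS
    have : IsProbabilityMeasure ((exclusiveCoupling M.μ E).map fun ε => ε i) := by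
      rw [hmap i]
      infer_instance
    exact Measure.isProbabilityMeasure_of_map fun ε => ε i
  refine ⟨_, hlaw, (expectedMaxUtility_eq_dualBound_iff hlaw hS l).2 ?_⟩
  filter_upwards [ae_exclusiveCoupling_existsUnique hmeas hsum] with ε ⟨k, hk, hunique⟩
  have hmem : ∀ j, ε j ∈ E j ↔ j ∈ S ∧ l < M.ν j + ε j := fun j => by
    by_cases hj : j ∈ S <;> simp [hE, hj, exceedSet, -EReal.coe_add]
  obtain ⟨hkS, hlk⟩ := (hmem k).1 hk
  exact ⟨k, hkS, hlk.le, fun j hj hjk =>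
    not_lt.1 fun hlj => hjk (hunique j ((hmem j).2 ⟨hj, hlj⟩))⟩

end Duality

section ChoiceProbabilities

variable {S T : Finset (Fin n)}

/-- The largest level at which the exceedance probabilities of the products in `T` still add up to
at least one. -/
noncomputable def level (T : Finset (Fin n)) : EReal :=
  sSup {l | 1 ≤ ∑ i ∈ T, M.exceedProb i l}

/-- The choice probabilities of the model, as exceedance probabilities at the common level. -/
noncomputable def choiceProb (T : Finset (Fin n)) (i : Fin n) : ℝ :=
  M.exceedProb i (M.level T)

theorem level_mono : Monotone M.level := fun _ _ h =>
  sSup_le_sSup fun _ hl => hl.trans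
    (Finset.sum_le_sum_of_subset_of_nonneg h fun i _ _ => M.exceedProb_nonneg i _)

theorem choiceProb_anti (hST : S ⊆ T) (i : Fin n) : M.choiceProb T i ≤ M.choiceProb S i :=
  M.antitone_exceedProb i (M.level_mono hST)

theorem sum_choiceProb (hT : T.Nonempty) : ∑ i ∈ T, M.choiceProb T i = 1 := by
  have hcont : Continuous fun l => ∑ i ∈ T, M.exceedProb i l :=
    continuous_finsetSum _ fun i _ => M.continuous_exceedProb i
  have hbot : 1 ≤ ∑ i ∈ T, M.exceedProb i ⊥ := by
    simp only [exceedProb_bot, Finset.sum_const, nsmul_eq_mul, mul_one]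
    exact Nat.one_le_cast.2 hT.card_pos
  have htop : ∑ i ∈ T, M.exceedProb i ⊤ ≤ 1 := by
    simp only [exceedProb_top, Finset.sum_const_zero, zero_le_one]
  obtain ⟨l, hl⟩ := mem_range_of_exists_le_of_exists_ge hcont ⟨⊤, htop⟩ ⟨⊥, hbot⟩
  refine le_antisymm ?_ ((isClosed_le continuous_const hcont).csSup_mem ⟨⊥, hbot⟩
    (OrderTop.bddAbove _))
  rw [← hl]
  exact Finset.sum_le_sum fun i _ => M.antitone_exceedProb i (le_sSup hl.ge)

theorem choiceProb_mem_simplexOn (hT : T.Nonempty) : M.choiceProb T ∈ simplexOn T :=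
  ⟨fun i _ => M.exceedProb_nonneg i _, M.sum_choiceProb hT⟩

theorem level_ne_top (hT : T.Nonempty) : M.level T ≠ ⊤ := fun h => by
  have := M.sum_choiceProb hT
  simp only [choiceProb, h, exceedProb_top, Finset.sum_const_zero, zero_ne_one] at this

theorem choiceProb_eq_of_sum_eq_one {l : EReal} (hl : ∑ i ∈ T, M.exceedProb i l = 1) {i : Fin n}
    (hi : i ∈ T) : M.choiceProb T i = M.exceedProb i l :=
  (Finset.sum_eq_sum_iff_of_le fun j _ => M.antitone_exceedProb j (le_sSup hl.ge)).1
    ((M.sum_choiceProb ⟨i, hi⟩).trans hl.symm) i hi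

theorem eq_singleton_or_exists_sum_exceedProb_eq_one (hT : T.Nonempty) :
    (∃ k, T = {k}) ∨ ∃ l : ℝ, ∑ i ∈ T, M.exceedProb i l = 1 := by
  have hsum := M.sum_choiceProb hT
  simp only [choiceProb] at hsum
  induction hl : M.level T with
  | bot =>
    rw [hl] at hsum
    simp only [exceedProb_bot, Finset.sum_const, nsmul_eq_mul, mul_one, Nat.cast_eq_one] at hsum
    exact .inl (Finset.card_eq_one.1 hsum)
  | coe l => exact .inr ⟨l, hl ▸ hsum⟩
  | top => exact absurd hl (M.level_ne_top hT)

theorem pi_mem_jointLaws : Measure.pi M.μ ∈ M.jointLaws :=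
  ⟨inferInstance, fun i => (measurePreserving_eval M.μ i).map_eq⟩

theorem expectedMaxUtility_singleton {θ : Measure (Fin n → ℝ)} (h : θ ∈ M.jointLaws) (k : Fin n) :
    M.expectedMaxUtility {k} θ = ∫ t, M.ν k + t ∂M.μ k := by
  rw [← h.2 k, integral_map (measurable_pi_apply k).aemeasurable (by fun_prop),
    expectedMaxUtility]
  congr with ε
  exact ciSup_unique (ι := {i // i ∈ ({k} : Finset (Fin n))})

theorem exists_isExtremal (hT : T.Nonempty) : ∃ θ, M.IsExtremal T θ := by
  obtain ⟨k, rfl⟩ | ⟨l, hl⟩ := M.eq_singleton_or_exists_sum_exceedProb_eq_one hT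
  · refine ⟨_, M.pi_mem_jointLaws, fun θ hθ => ?_⟩
    rw [M.expectedMaxUtility_singleton hθ, M.expectedMaxUtility_singleton M.pi_mem_jointLaws]
  · obtain ⟨θ, hθ, heq⟩ := exists_expectedMaxUtility_eq_dualBound hl
    exact ⟨θ, hθ, fun θ' hθ' => (expectedMaxUtility_le_dualBound hθ' hT l).trans_eq heq.symm⟩

variable {M}

theorem IsExtremal.measureReal_argmaxEvent {θ : Measure (Fin n → ℝ)} (h : M.IsExtremal T θ)
    {i : Fin n} (hi : i ∈ T) : θ.real (M.argmaxEvent T i) = M.choiceProb T i := by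
  obtain ⟨k, rfl⟩ | ⟨l, hl⟩ := M.eq_singleton_or_exists_sum_exceedProb_eq_one ⟨i, hi⟩
  · obtain rfl := Finset.mem_singleton.1 hi
    have := h.1.1
    have huniv : M.argmaxEvent {i} i = Set.univ := Set.eq_univ_of_forall fun ε j hj => by
      rw [Finset.mem_singleton.1 hj]
    rw [huniv, probReal_univ, ← M.sum_choiceProb ⟨i, hi⟩, Finset.sum_singleton]
  · obtain ⟨θ', hθ', heq⟩ := exists_expectedMaxUtility_eq_dualBound hl
    rw [M.choiceProb_eq_of_sum_eq_one hl hi, measureReal_argmaxEvent_of_eq_dualBound h.1 ?_ hi]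
    exact (expectedMaxUtility_le_dualBound h.1 ⟨i, hi⟩ l).antisymm (heq ▸ h.2 θ' hθ')

theorem generates_iff (hT : T.Nonempty) {q : Fin n → ℝ} :
    M.Generates T q ↔ ∀ i ∈ T, q i = M.choiceProb T i := by
  constructor
  · rintro ⟨θ, hθ, hq⟩ i hi
    rw [hq i hi, hθ.measureReal_argmaxEvent hi]
  · intro hq
    obtain ⟨θ, hθ⟩ := M.exists_isExtremal hT
    exact ⟨θ, hθ, fun i hi => (hq i hi).trans (hθ.measureReal_argmaxEvent hi).symm⟩

end ChoiceProbabilities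

/-! ### Rescaled models -/

/-- The model in which the utility of each product `i` is rescaled by `e i`; the deterministic
utilities are absorbed into the random terms. -/
noncomputable def transform (e : Fin n → ℝ ≃o ℝ) (he : ∀ i, IsBilipschitz (e i)) : MDM n where
  ν := 0
  μ i := (M.μ i).map ((OrderIso.addLeft (M.ν i)).trans (e i))
  isProbabilityMeasure i :=
    Measure.isProbabilityMeasure_map (OrderIso.continuous _).measurable.aemeasurable
  absolutelyContinuous i := .mk fun s hs h0 => by
    rw [Measure.map_apply (OrderIso.continuous _).measurable hs]
    exact M.absolutelyContinuous i
      (((isBilipschitz_addLeft _).trans (he i)).volume_preimage_eq_zero h0)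
  strictMonoOn_cdf i := strictMonoOn_cdf_map_orderIso (M.strictMonoOn_cdf i) _
  integrable i := by
    obtain ⟨K, hK⟩ := ((isBilipschitz_addLeft (M.ν i)).trans (he i)).1
    rw [integrable_map_measure (by fun_prop) hK.continuous.measurable.aemeasurable]
    exact integrable_comp_of_lipschitzWith hK (M.integrable i)

theorem exceedProb_transform (e : Fin n → ℝ ≃o ℝ) (he : ∀ i, IsBilipschitz (e i)) (i : Fin n)
    (y : ℝ) : (M.transform e he).exceedProb i (e i y : ℝ) = M.exceedProb i y := by
  refine (map_measureReal_apply (OrderIso.continuous _).measurable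
    (measurableSet_exceedSet _ _ _)).trans (congrArg _ (Set.ext fun t => ?_))
  have hutility : (M.transform e he).ν i + (OrderIso.addLeft (M.ν i)).trans (e i) t =
      e i (M.ν i + t) := zero_add _
  simp only [exceedSet, Set.mem_preimage, Set.mem_ofPred_eq, EReal.coe_lt_coe_iff, hutility,
    OrderIso.lt_iff_lt]

theorem exists_abs_exceedProb_sub_lt {A : Finset (Fin n)} {Λ : Fin n → Finset EReal} {s : ℝ}
    {x : Fin n → ℝ} (hs : ∀ i ∈ A, (s : EReal) ∉ Λ i) (hx : ∀ i ∈ A, x i ∈ Set.Icc 0 1)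
    (hlt : ∀ i ∈ A, ∀ l ∈ Λ i, l < s → x i ≤ M.exceedProb i l)
    (hgt : ∀ i ∈ A, ∀ l ∈ Λ i, s < l → M.exceedProb i l ≤ x i) {δ : ℝ} (hδ : 0 < δ) :
    ∃ M' : MDM n, (∀ i, ∀ l ∈ Λ i, M'.exceedProb i l = M.exceedProb i l) ∧
      ∀ i ∈ A, |M'.exceedProb i s - x i| < δ := by
  have hrescale : ∀ i, ∃ e : ℝ ≃o ℝ, IsBilipschitz e ∧ (∀ y : ℝ, (y : EReal) ∈ Λ i → e y = y) ∧
      (i ∈ A → |M.exceedProb i (e.symm s : ℝ) - x i| < δ) := by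
    intro i
    by_cases hi : i ∈ A
    · obtain ⟨e, he, hfix, hnear⟩ := exists_isBilipschitz_abs_symm_apply_sub_lt
        (M.continuous_exceedProb i) (hs i hi)
        (by simpa only [exceedProb_top, exceedProb_bot] using hx i hi) (hlt i hi) (hgt i hi) hδ
      exact ⟨e, he, hfix, fun _ => hnear⟩
    · exact ⟨OrderIso.refl ℝ, isBilipschitz_refl, fun y _ => rfl, fun h => absurd h hi⟩
  choose e he hfix hnear using hrescale
  refine ⟨M.transform e he, fun i l hl => ?_, fun i hi => ?_⟩
  · induction l with
    | bot => simp only [exceedProb_bot]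
    | coe y => rw [← M.exceedProb_transform e he, hfix i y hl]
    | top => simp only [exceedProb_top]
  · rw [← (e i).apply_symm_apply s, exceedProb_transform]
    exact hnear i hi

theorem abs_choiceProb_sub_le {A : Finset (Fin n)} {x : Fin n → ℝ} (hx : x ∈ simplexOn A)
    {l : EReal} {δ : ℝ} (h : ∀ i ∈ A, |M.exceedProb i l - x i| ≤ δ) {i : Fin n} (hi : i ∈ A) :
    |M.choiceProb A i - x i| ≤ (A.card + 1) * δ := by
  have hcomparable : (∀ j ∈ A, M.choiceProb A j ≤ M.exceedProb j l) ∨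
      ∀ j ∈ A, M.exceedProb j l ≤ M.choiceProb A j :=
    (le_total l (M.level A)).imp (fun hle j _ => M.antitone_exceedProb j hle)
      fun hle j _ => M.antitone_exceedProb j hle
  have hsum : |∑ j ∈ A, M.choiceProb A j - ∑ j ∈ A, M.exceedProb j l| ≤ A.card * δ := by
    rw [M.sum_choiceProb ⟨i, hi⟩, ← hx.2, abs_sub_comm, ← Finset.sum_sub_distrib, ← nsmul_eq_mul]
    exact (Finset.abs_sum_le_sum_abs _ _).trans (Finset.sum_le_card_nsmul _ _ _ h)
  linarith [abs_sub_le (M.choiceProb A i) (M.exceedProb i l) (x i),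
    abs_sub_le_abs_sum_sub hcomparable hi, h i hi]

end MDM

/-! ### Nested assortments -/

section Simplex

variable {n : ℕ} {A : Finset (Fin n)} {x : Fin n → ℝ}

theorem nonempty_of_mem_simplexOn (hx : x ∈ simplexOn A) : A.Nonempty :=
  Finset.nonempty_of_sum_ne_zero (hx.2.trans_ne one_ne_zero)

theorem mem_Icc_of_mem_simplexOn (hx : x ∈ simplexOn A) {i : Fin n} (hi : i ∈ A) :
    x i ∈ Set.Icc 0 1 :=
  ⟨hx.1 i hi, hx.2 ▸ Finset.single_le_sum hx.1 hi⟩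

theorem simplexOn_congr {y : Fin n → ℝ} (h : ∀ i ∈ A, x i = y i) :
    x ∈ simplexOn A ↔ y ∈ simplexOn A := by
  simp only [simplexOn, Set.mem_ofPred_eq, Finset.sum_congr rfl h]
  exact and_congr_left fun _ => forall₂_congr fun i hi => by rw [h i hi]

theorem isClosed_simplexOn : IsClosed (simplexOn A) := by
  simp only [simplexOn, Set.ofPred_and, Set.ofPred_forall]
  exact (isClosed_biInter fun i _ => isClosed_le continuous_const (continuous_apply i)).inter
    (isClosed_eq (by fun_prop) continuous_const)

end Simplex

section Revenue

variable {n : ℕ} (r : Fin n → ℝ) (A : Finset (Fin n))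

theorem continuous_revenue : Continuous (revenue r A) := by
  unfold revenue
  fun_prop

theorem infRevenue_closure (C : Set (Fin n → ℝ)) :
    infRevenue r A (closure C) = infRevenue r A C := by
  refine le_antisymm (biInf_mono fun _ h => subset_closure h) (le_iInf₂ fun x hx => ?_)
  have hsub : C ⊆ {y | infRevenue r A C ≤ ((revenue r A y : ℝ) : EReal)} := fun y hy =>
    iInf₂_le (f := fun y _ => ((revenue r A y : ℝ) : EReal)) y hy
  exact closure_minimal hsub
    (isClosed_le continuous_const (continuous_coe_real_ereal.comp (continuous_revenue r A))) hx

variable {A}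

theorem exists_infRevenue_eq {C : Set (Fin n → ℝ)} (hclosed : IsClosed C) (hC : C ⊆ simplexOn A)
    (hrestrict : ∀ x ∈ C, A.piecewise x 0 ∈ C) (hne : C.Nonempty) :
    ∃ x ∈ C, infRevenue r A C = ((revenue r A x : ℝ) : EReal) := by
  have hmem : ∀ x ∈ C, A.piecewise x 0 ∈ C ∩ Set.Icc 0 1 := fun x hx => by
    refine ⟨hrestrict x hx, fun i => ?_, fun i => ?_⟩ <;> by_cases hi : i ∈ A
    · exact (mem_Icc_of_mem_simplexOn (hC hx) hi).1.trans_eq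
        (Finset.piecewise_eq_of_mem _ _ _ hi).symm
    · simp only [Finset.piecewise_eq_of_notMem _ _ _ hi, le_refl]
    · exact (Finset.piecewise_eq_of_mem A x 0 hi).trans_le (mem_Icc_of_mem_simplexOn (hC hx) hi).2
    · simp only [Finset.piecewise_eq_of_notMem _ _ _ hi, Pi.zero_apply, Pi.one_apply, zero_le_one]
  obtain ⟨y, hy, hmin⟩ := (isCompact_Icc.inter_left hclosed).exists_isMinOn
    (let ⟨x, hx⟩ := hne; ⟨_, hmem x hx⟩) (continuous_revenue r A).continuousOn
  refine ⟨y, hy.1, le_antisymm (iInf₂_le y hy.1) (le_iInf₂ fun x hx => ?_)⟩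
  have hrevenue : revenue r A (A.piecewise x 0) = revenue r A x :=
    Finset.sum_congr rfl fun i hi => by rw [Finset.piecewise_eq_of_mem _ _ _ hi]
  rw [EReal.coe_le_coe_iff, ← hrevenue]
  exact hmin (hmem x hx)

end Revenue

section Representation

variable {n : ℕ} {𝒮 : Finset (Finset (Fin n))} {p : Finset (Fin n) → Fin n → ℝ}
  {A : Finset (Fin n)}

theorem mem_mdmProbabilities_iff : p ∈ mdmProbabilities 𝒮 ↔
    ∃ M : MDM n, ∀ T ∈ 𝒮, T.Nonempty ∧ ∀ i ∈ T, p T i = M.choiceProb T i := by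
  constructor
  · rintro ⟨hsimplex, M, hM⟩
    refine ⟨M, fun T hT => ?_⟩
    have hne := nonempty_of_mem_simplexOn (hsimplex T hT)
    exact ⟨hne, (MDM.generates_iff hne).1 (hM T hT)⟩
  · rintro ⟨M, hM⟩
    exact ⟨fun T hT => (simplexOn_congr (hM T hT).2).2 (M.choiceProb_mem_simplexOn (hM T hT).1),
      M, fun T hT => (MDM.generates_iff (hM T hT).1).2 (hM T hT).2⟩

theorem mem_consistentSet_iff (hA𝒮 : A ∉ 𝒮) {x : Fin n → ℝ} : x ∈ consistentSet 𝒮 p A ↔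
    ∃ M : MDM n, (A.Nonempty ∧ ∀ i ∈ A, x i = M.choiceProb A i) ∧
      ∀ T ∈ 𝒮, T.Nonempty ∧ ∀ i ∈ T, p T i = M.choiceProb T i := by
  rw [consistentSet, Set.mem_ofPred_eq, mem_mdmProbabilities_iff]
  simp only [Finset.forall_mem_insert, Function.update_self]
  refine exists_congr fun M => and_congr_right fun _ => forall₂_congr fun T hT => ?_
  rw [Function.update_of_ne (ne_of_mem_of_not_mem hT hA𝒮)]

theorem consistentSet_nonempty (hp : p ∈ mdmProbabilities 𝒮) (hA : A.Nonempty) (hA𝒮 : A ∉ 𝒮) :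
    (consistentSet 𝒮 p A).Nonempty := by
  obtain ⟨M, hM⟩ := mem_mdmProbabilities_iff.1 hp
  exact ⟨M.choiceProb A, (mem_consistentSet_iff hA𝒮).2 ⟨M, ⟨hA, fun _ _ => rfl⟩, hM⟩⟩

end Representation

section Nested

variable {n m : ℕ} {𝒮 : Finset (Finset (Fin n))} {S : Fin m → Finset (Fin n)}
  {p : Finset (Fin n) → Fin n → ℝ} {A : Finset (Fin n)} {k : Fin (m + 1)} {x : Fin n → ℝ}

theorem antitone_of_mem_mdmProbabilities (hp : p ∈ mdmProbabilities 𝒮) {T U : Finset (Fin n)}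
    (hT : T ∈ 𝒮) (hU : U ∈ 𝒮) (hTU : T ⊆ U) {i : Fin n} (hi : i ∈ T) : p U i ≤ p T i := by
  obtain ⟨M, hM⟩ := mem_mdmProbabilities_iff.1 hp
  rw [(hM T hT).2 i hi, (hM U hU).2 i (hTU hi)]
  exact M.choiceProb_anti hTU i

theorem mem_nestedFeasible_iff (hS : IsNestedEnumeration 𝒮 S) (hp : p ∈ mdmProbabilities 𝒮) :
    x ∈ nestedFeasible 𝒮 S p A k ↔
      (∀ j, j.castSucc < k → ∀ i ∈ A ∩ S j, x i ≤ p (S j) i) ∧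
      (∀ j, k ≤ j.castSucc → ∀ i ∈ A ∩ S j, p (S j) i ≤ x i) ∧ x ∈ simplexOn A := by
  have hmem : ∀ j, S j ∈ 𝒮 := fun j => (hS.2 _).2 ⟨j, rfl⟩
  constructor
  · rintro ⟨hupper, hlower, hx⟩
    refine ⟨fun j hj i hi => ?_, fun j hj => ?_, hx⟩
    · obtain ⟨q, rfl⟩ := Fin.exists_succ_eq.2 (Fin.ne_zero_of_lt hj)
      have hjq : S j ⊆ S q := hS.1.monotone (Fin.castSucc_lt_succ_iff.1 hj)
      rw [Finset.mem_inter] at hi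
      exact (hupper q rfl i (Finset.mem_inter.2 ⟨hi.1, hjq hi.2⟩)).trans
        (antitone_of_mem_mdmProbabilities hp (hmem j) (hmem q) hjq hi.2)
    · exact hlower ⟨k, lt_of_le_of_lt hj j.2⟩ rfl (S j) (hmem j) (hS.1.monotone hj)
  · rintro ⟨hupper, hlower, hx⟩
    refine ⟨fun j hj => hupper j ?_, fun j hj T hT hjT => ?_, hx⟩
    · exact Fin.lt_def.2 (hj ▸ Nat.lt_succ_self j)
    · obtain ⟨q, rfl⟩ := (hS.2 T).1 hT
      exact hlower q (Fin.le_def.2 (hj ▸ hS.1.le_iff_le.1 hjT))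

theorem nestedFeasible_subset_simplexOn : nestedFeasible 𝒮 S p A k ⊆ simplexOn A :=
  fun _ hx => hx.2.2

theorem isClosed_nestedFeasible : IsClosed (nestedFeasible 𝒮 S p A k) := by
  simp only [nestedFeasible, Set.ofPred_and, Set.ofPred_forall]
  refine .inter ?_ (.inter ?_ isClosed_simplexOn)
  · exact isClosed_iInter fun j => isClosed_iInter fun _ => isClosed_biInter fun i _ =>
      isClosed_le (continuous_apply i) continuous_const
  · exact isClosed_iInter fun j => isClosed_iInter fun _ => isClosed_iInter fun T =>
      isClosed_iInter fun _ => isClosed_iInter fun _ => isClosed_biInter fun i _ =>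
      isClosed_le continuous_const (continuous_apply i)

theorem piecewise_mem_nestedFeasible (hx : x ∈ nestedFeasible 𝒮 S p A k) (y : Fin n → ℝ) :
    A.piecewise x y ∈ nestedFeasible 𝒮 S p A k := by
  have heq : ∀ i ∈ A, A.piecewise x y i = x i := fun i hi => Finset.piecewise_eq_of_mem _ _ _ hi
  refine ⟨fun j hj i hi => ?_, fun j hj T hT hjT i hi => ?_, (simplexOn_congr heq).2 hx.2.2⟩
  · rw [heq i (Finset.mem_inter.1 hi).1]
    exact hx.1 j hj i hi
  · rw [heq i (Finset.mem_inter.1 hi).1]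
    exact hx.2.1 j hj T hT hjT i hi

theorem exists_nestedValue_eq (r : Fin n → ℝ) (hne : (nestedFeasible 𝒮 S p A k).Nonempty) :
    ∃ x ∈ nestedFeasible 𝒮 S p A k, nestedValue 𝒮 S p r A k = ((revenue r A x : ℝ) : EReal) :=
  exists_infRevenue_eq r isClosed_nestedFeasible nestedFeasible_subset_simplexOn
    (fun _ hx => piecewise_mem_nestedFeasible hx 0) hne

theorem consistentSet_subset_iUnion_nestedFeasible (hS : IsNestedEnumeration 𝒮 S)
    (hp : p ∈ mdmProbabilities 𝒮) (hA𝒮 : A ∉ 𝒮) :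
    consistentSet 𝒮 p A ⊆ ⋃ k, nestedFeasible 𝒮 S p A k := by
  intro x hx
  obtain ⟨M, ⟨hA, hxA⟩, hM⟩ := (mem_consistentSet_iff hA𝒮).1 hx
  have hpS : ∀ j, ∀ i ∈ S j, p (S j) i = M.choiceProb (S j) i :=
    fun j => (hM _ ((hS.2 _).2 ⟨j, rfl⟩)).2
  obtain ⟨k, hk, hmin⟩ := wellFounded_lt.has_min
    {k : Fin (m + 1) | ∀ j : Fin m, k ≤ j.castSucc → M.level A ≤ M.level (S j)}
    ⟨Fin.last m, fun j hj => absurd hj (Fin.castSucc_lt_last j).not_ge⟩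
  have hlt : ∀ j : Fin m, j.castSucc < k → M.level (S j) ≤ M.level A := by
    intro j hj
    by_contra! hlevel
    exact hmin _ (fun q hq => hlevel.le.trans (M.level_mono (hS.1.monotone hq))) hj
  refine Set.mem_iUnion.2 ⟨k, (mem_nestedFeasible_iff hS hp).2
    ⟨fun j hj i hi => ?_, fun j hj i hi => ?_,
      (simplexOn_congr hxA).2 (M.choiceProb_mem_simplexOn hA)⟩⟩ <;>
    obtain ⟨hiA, hij⟩ := Finset.mem_inter.1 hi <;> rw [hxA i hiA, hpS j i hij]
  · exact M.antitone_exceedProb i (hlt j hj)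
  · exact M.antitone_exceedProb i (hk j hj)

theorem MDM.exists_separating_level (M : MDM n) (hS : Monotone S)
    (hx : ∀ i ∈ A, x i ∈ Set.Icc 0 1)
    (hupper : ∀ j, j.castSucc < k → ∀ i ∈ A ∩ S j, x i ≤ M.choiceProb (S j) i)
    (hlower : ∀ j, k ≤ j.castSucc → ∀ i ∈ A ∩ S j, M.choiceProb (S j) i ≤ x i) :
    ∃ s : ℝ, ∀ j, M.level (S j) ≠ s ∧ ∀ i ∈ A ∩ S j,
      (M.level (S j) < s → x i ≤ M.choiceProb (S j) i) ∧
      (s < M.level (S j) → M.choiceProb (S j) i ≤ x i) := by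
  -- A level `⊥` below `s` is harmless since all products then have probability one. A member
  -- before `k` with a level `≥ b` inherits its lower bound from the one attaining `b`.
  set b := (Finset.univ.filter fun j => k ≤ j.castSucc ∧ M.level (S j) ≠ ⊥).inf
    fun j => M.level (S j)
  have hbot : ⊥ < b := (Finset.lt_inf_iff bot_lt_top).2 fun j hj =>
    bot_lt_iff_ne_bot.2 (Finset.mem_filter.1 hj).2.2
  have hexceed : ∀ j, j.castSucc < k → ∀ i ∈ A ∩ S j, M.exceedProb i b ≤ x i := by
    intro j hj i hi
    obtain ⟨hiA, hij⟩ := Finset.mem_inter.1 hi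
    refine Finset.inf_induction (p := fun l => M.exceedProb i l ≤ x i) ?_ ?_ fun q hq => ?_
    · exact (M.exceedProb_top i).trans_le (hx i hiA).1
    · exact fun l hl l' hl' => by rcases min_choice l l' with h | h <;> rwa [h]
    · have hkq := (Finset.mem_filter.1 hq).2.1
      exact hlower q hkq i (Finset.mem_inter.2 ⟨hiA, hS (hj.trans_le hkq).le hij⟩)
  obtain ⟨s, hs, hsb⟩ := EReal.lt_iff_exists_real_btwn.1 <|
    (Finset.sup_lt_iff hbot (s := Finset.univ.filter fun j => M.level (S j) < b)
      (f := fun j => M.level (S j))).2 fun j hj => (Finset.mem_filter.1 hj).2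
  have hltS : ∀ j, M.level (S j) < b → M.level (S j) < s := fun j hj =>
    (Finset.le_sup (f := fun j => M.level (S j))
      (Finset.mem_filter.2 ⟨Finset.mem_univ j, hj⟩)).trans_lt hs
  refine ⟨s, fun j => ⟨fun h => (hltS j (h ▸ hsb)).ne h, fun i hi =>
    ⟨fun hjs => ?_, fun hsj => ?_⟩⟩⟩
  · rcases lt_or_ge j.castSucc k with hj | hj
    · exact hupper j hj i hi
    · have hlevel : M.level (S j) = ⊥ := by_contra fun hne => (hjs.trans hsb).not_ge
        (Finset.inf_le (Finset.mem_filter.2 ⟨Finset.mem_univ j, hj, hne⟩))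
      rw [choiceProb, hlevel, exceedProb_bot]
      exact (hx i (Finset.mem_inter.1 hi).1).2
  · rcases lt_or_ge j.castSucc k with hj | hj
    · refine (M.antitone_exceedProb i ?_).trans (hexceed j hj i hi)
      exact not_lt.1 fun hjb => hsj.not_gt (hltS j hjb)
    · exact hlower j hj i hi

theorem MDM.exists_choiceProb_near (M : MDM n) (hx : x ∈ simplexOn A) {s : ℝ}
    (hs : ∀ T ∈ 𝒮, M.level T ≠ s ∧ ∀ i ∈ A ∩ T,
      (M.level T < s → x i ≤ M.choiceProb T i) ∧ (s < M.level T → M.choiceProb T i ≤ x i))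
    {δ : ℝ} (hδ : 0 < δ) :
    ∃ M' : MDM n, (∀ T ∈ 𝒮, ∀ i ∈ T, M'.choiceProb T i = M.choiceProb T i) ∧
      ∀ i ∈ A, |M'.choiceProb A i - x i| < δ := by
  set Λ : Fin n → Finset EReal := fun i => (𝒮.filter (i ∈ ·)).image M.level with hΛ
  have hforall : ∀ {P : EReal → Prop} {i}, (∀ l ∈ Λ i, P l) ↔ ∀ T ∈ 𝒮, i ∈ T → P (M.level T) := by
    simp only [hΛ, Finset.forall_mem_image, Finset.mem_filter, and_imp, implies_true]
  set η := δ / (A.card + 2) with hη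
  have hη0 : 0 < η := by positivity
  obtain ⟨M', hM', hnear⟩ := M.exists_abs_exceedProb_sub_lt (Λ := Λ)
    (fun i _ hsi => (hforall (P := (· ≠ (s : EReal))) (i := i)).2
      (fun T hT _ => (hs T hT).1) s hsi rfl)
    (fun i hi => mem_Icc_of_mem_simplexOn hx hi)
    (fun i hi => hforall.2 fun T hT hiT => ((hs T hT).2 i (Finset.mem_inter.2 ⟨hi, hiT⟩)).1)
    (fun i hi => hforall.2 fun T hT hiT => ((hs T hT).2 i (Finset.mem_inter.2 ⟨hi, hiT⟩)).2) hη0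
  have hexceed : ∀ T ∈ 𝒮, ∀ i ∈ T, M'.exceedProb i (M.level T) = M.choiceProb T i :=
    fun T hT i hi => hforall.1 (hM' i) T hT hi
  refine ⟨M', fun T hT i hi => ?_, fun i hi => ?_⟩
  · rw [M'.choiceProb_eq_of_sum_eq_one _ hi, hexceed T hT i hi]
    rw [Finset.sum_congr rfl (hexceed T hT), M.sum_choiceProb ⟨i, hi⟩]
  · calc |M'.choiceProb A i - x i| ≤ (A.card + 1) * η :=
          M'.abs_choiceProb_sub_le hx (fun j hj => (hnear j hj).le) hi
      _ < (A.card + 2) * η := by linarith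
      _ = δ := mul_div_cancel₀ _ (by positivity)

theorem nestedFeasible_subset_closure_consistentSet (hS : IsNestedEnumeration 𝒮 S)
    (hp : p ∈ mdmProbabilities 𝒮) (hA𝒮 : A ∉ 𝒮) :
    nestedFeasible 𝒮 S p A k ⊆ closure (consistentSet 𝒮 p A) := by
  intro x hx
  obtain ⟨M, hM⟩ := mem_mdmProbabilities_iff.1 hp
  have hpS : ∀ j, ∀ i ∈ A ∩ S j, p (S j) i = M.choiceProb (S j) i :=
    fun j i hi => (hM _ ((hS.2 _).2 ⟨j, rfl⟩)).2 i (Finset.mem_inter.1 hi).2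
  obtain ⟨hupper, hlower, hsimplex⟩ := (mem_nestedFeasible_iff hS hp).1 hx
  obtain ⟨s, hs⟩ := M.exists_separating_level hS.1.monotone
    (fun i hi => mem_Icc_of_mem_simplexOn hsimplex hi)
    (fun j hj i hi => hpS j i hi ▸ hupper j hj i hi)
    (fun j hj i hi => hpS j i hi ▸ hlower j hj i hi)
  refine Metric.mem_closure_iff.2 fun δ hδ => ?_
  obtain ⟨M', hM', hnear⟩ := M.exists_choiceProb_near (𝒮 := 𝒮) hsimplex
    (fun T hT => by obtain ⟨j, rfl⟩ := (hS.2 T).1 hT; exact hs j) hδ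
  refine ⟨A.piecewise (M'.choiceProb A) x, (mem_consistentSet_iff hA𝒮).2 ⟨M', ⟨?_, ?_⟩, ?_⟩, ?_⟩
  · exact nonempty_of_mem_simplexOn hsimplex
  · exact fun i hi => Finset.piecewise_eq_of_mem _ _ _ hi
  · exact fun T hT => ⟨(hM T hT).1, fun i hi => ((hM T hT).2 i hi).trans (hM' T hT i hi).symm⟩
  · refine (dist_pi_lt_iff hδ).2 fun i => ?_
    by_cases hi : i ∈ A
    · rw [Finset.piecewise_eq_of_mem _ _ _ hi, dist_comm, Real.dist_eq]
      exact hnear i hi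
    · rwa [Finset.piecewise_eq_of_notMem _ _ _ hi, dist_self]

theorem closure_consistentSet (hS : IsNestedEnumeration 𝒮 S) (hp : p ∈ mdmProbabilities 𝒮)
    (hA𝒮 : A ∉ 𝒮) : closure (consistentSet 𝒮 p A) = ⋃ k, nestedFeasible 𝒮 S p A k :=
  (closure_minimal (consistentSet_subset_iUnion_nestedFeasible hS hp hA𝒮)
    (isClosed_iUnion_of_finite fun _ => isClosed_nestedFeasible)).antisymm
    (Set.iUnion_subset fun _ => nestedFeasible_subset_closure_consistentSet hS hp hA𝒮)

theorem worstCaseRevenue_eq_iInf_nestedValue (hS : IsNestedEnumeration 𝒮 S)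
    (hp : p ∈ mdmProbabilities 𝒮) (hA𝒮 : A ∉ 𝒮) (r : Fin n → ℝ) :
    worstCaseRevenue 𝒮 p r A = ⨅ k, nestedValue 𝒮 S p r A k := by
  rw [worstCaseRevenue, ← infRevenue_closure, closure_consistentSet hS hp hA𝒮]
  exact iInf_iUnion _ _

end Nested

theorem proposition3_general {n m : ℕ} (𝒮 : Finset (Finset (Fin n))) (S : Fin m → Finset (Fin n))
    (hS : IsNestedEnumeration 𝒮 S)
    (p : Finset (Fin n) → Fin n → ℝ) (hp : p ∈ mdmProbabilities 𝒮) (r : Fin n → ℝ)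
    (A : Finset (Fin n)) (hA : A.Nonempty) (hA𝒮 : A ∉ 𝒮) :
    IsLeast (Set.range (nestedValue 𝒮 S p r A)) (worstCaseRevenue 𝒮 p r A) ∧
    (∀ k : Fin (m + 1), (nestedFeasible 𝒮 S p A k).Nonempty →
      ∃ x ∈ nestedFeasible 𝒮 S p A k, nestedValue 𝒮 S p r A k = ((revenue r A x : ℝ) : EReal)) ∧
    ∃ k : Fin (m + 1), (nestedFeasible 𝒮 S p A k).Nonempty := by
  refine ⟨?_, fun k => exists_nestedValue_eq r, ?_⟩
  · rw [worstCaseRevenue_eq_iInf_nestedValue hS hp hA𝒮]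
    exact ⟨exists_eq_ciInf_of_finite, fun _ ⟨k, hk⟩ => hk ▸ iInf_le _ k⟩
  · rw [← Set.nonempty_iUnion, ← closure_consistentSet hS hp hA𝒮, closure_nonempty_iff]
    exact consistentSet_nonempty hp hA hA𝒮

theorem proposition3 {n m : ℕ} (𝒮 : Finset (Finset (Fin n))) (S : Fin m → Finset (Fin n))
    (hS : IsNestedEnumeration 𝒮 S)
    (p : Finset (Fin n) → Fin n → ℝ) (hp : p ∈ mdmProbabilities 𝒮)
    (r : Fin n → ℝ) (hr : ∀ i, 0 < r i)
    (A : Finset (Fin n)) (hA : A.Nonempty) (hA𝒮 : A ∉ 𝒮) :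
    IsLeast (Set.range (nestedValue 𝒮 S p r A)) (worstCaseRevenue 𝒮 p r A) ∧
    (∀ k : Fin (m + 1), (nestedFeasible 𝒮 S p A k).Nonempty →
      ∃ x ∈ nestedFeasible 𝒮 S p A k, nestedValue 𝒮 S p r A k = ((revenue r A x : ℝ) : EReal)) ∧
    ∃ k : Fin (m + 1), (nestedFeasible 𝒮 S p A k).Nonempty :=
  proposition3_general 𝒮 S hS p hp r A hA hA𝒮
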